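/- Let $\Omega\subset\mathbb{R}^d$ be closed and convex, let $1<p<\infty$, and let $W_p(\Omega)$ be the set of probability measures on $\Omega$ with finite $p$-th moment, endowed with the Wasserstein distance of order $p$. A velocity field of a Lipschitz curve $\mu:[0,1]\to W_p(\Omega)$ is a vector field $v:[0,1]\times\Omega\to\mathbb{R}^d$ such that $v_t=v(t,\cdot)\in L^p(\mu_t;\mathbb{R}^d)$ for a.e. $t\in[0,1]$ and such that, for every $\phi\in C^1_c(\Omega)$ (the restrictions to $\Omega$ of functions in $C^1_c(\mathbb{R}^d)$), the function $s\mapsto\int_\Omega\nabla\phi\cdot v_s\,d\mu_s$ is integrable on $[0,1]$ and $$\int_\Omega\phi\,d\mu_{t_2}-\int_\Omega\phi\,d\mu_{t_1}=\int_{t_1}^{t_2}\int_\Omega\nabla\phi\cdot v_s\,d\mu_s\,ds\qquad\text{for all } t_1<t_2 \text{ in } [0,1].$$ **Theorem.** Let $\mu:[0,1]\to W_p(\Omega)$ be a Lipschitz curve with velocity field $v$. Let $T:[0,1]\times\Omega\to\Omega$ be smooth (that is, the restriction of a $C^\infty$ map defined on an open neighbourhood of $[0,1]\times\Omega$; derivatives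 are those of this map), and suppose that for every $t\in[0,1]$ the map $T_t=T(t,\cdot)$ is a diffeomorphism of $\Omega$ onto itself. Suppose also that there is a constant $C$ with $$\|\nabla T_t(x)\|\le C,\qquad \left|\frac{\partial T}{\partial t}(t,x)\right|\le C(1+|x|)\qquad\text{for all } t\in[0,1],\ x\in\Omega$$ (which is automatic if $\Omega$ is bounded). Put $\mu'_t=(T_t)_\sharp\mu_t$. Then $t\mapsto\mu'_t$ is a Lipschitz curve in $W_p(\Omega)$; there is a vector field $v'$ such that, for a.e. $t\in[0,1]$, $v'_t$ is $\mu'_t$-integrable and $$v'_t\cdot\mu'_t=(T_t)_\sharp\left[\left(\nabla T_t\cdot v_t+\frac{\partial T}{\partial t}\right)\mu_t\right]$$ as vector measures; and every such $v'$ is a velocity field for $\mu'$. -/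

import Mathlib

open MeasureTheory Set
open scoped ENNReal NNReal ContDiff

/-- A coupling (transport plan) of `μ` and `ν`: a measure on the product with marginals
`μ` and `ν`. -/
def IsCoupling {E : Type*} [MeasurableSpace E] (π : Measure (E × E)) (μ ν : Measure E) : Prop :=
  π.map Prod.fst = μ ∧ π.map Prod.snd = ν

/-- The Wasserstein distance of order `p`:
`W_p(μ, ν) = (inf over couplings π of ∫ |x - y| ^ p dπ) ^ (1 / p)`. -/
noncomputable def wassersteinDist {E : Type*} [MeasurableSpace E] [PseudoEMetricSpace E]
    (p : ℝ) (μ ν : Measure E) : ℝ≥0∞ :=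
  (⨅ (π : Measure (E × E)) (_ : IsCoupling π μ ν), ∫⁻ z, edist z.1 z.2 ^ p ∂π) ^ (1 / p)

/-- The set `W_p(Ω)` of probability measures on `Ω` with finite `p`-th moment. A measure on `Ω` is
represented by the measure on the ambient space that gives no mass to the complement of `Ω`. -/
def wassersteinSpace {E : Type*} [MeasurableSpace E] [NormedAddCommGroup E]
    (p : ℝ) (Ω : Set E) : Set (Measure E) :=
  {μ | IsProbabilityMeasure μ ∧ μ Ωᶜ = 0 ∧ ∫⁻ x, ‖x‖ₑ ^ p ∂μ < ⊤}

/-- `t ↦ μ t`, `t ∈ [0, 1]`, is a Lipschitz curve in `W_p(Ω)`.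
Values of `μ` at times outside `[0, 1]` are irrelevant. -/
def IsLipschitzCurve {E : Type*} [MeasurableSpace E] [NormedAddCommGroup E]
    (p : ℝ) (Ω : Set E) (μ : ℝ → Measure E) : Prop :=
  (∀ t ∈ Icc (0 : ℝ) 1, μ t ∈ wassersteinSpace p Ω) ∧
    ∃ L : ℝ≥0, ∀ s ∈ Icc (0 : ℝ) 1, ∀ t ∈ Icc (0 : ℝ) 1,
      wassersteinDist p (μ s) (μ t) ≤ L * edist s t

/-- `v` is a velocity field of the curve `μ` (for the exponent `p`): for a.e. `t` the field `v t`
belongs to `L^p(μ t)`, and the continuity equation holds in the integrated weak form.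
The test functions in `C¹_c(Ω)`, for closed `Ω`, are the restrictions to `Ω` of the functions in
`C¹_c(ℝ^d)`; as the measures `μ t` live on `Ω`, only these restrictions (and their gradients at
points of `Ω`) enter. `fderiv ℝ φ x (v s x)` is the scalar product of `∇φ(x)` and `v_s(x)`.
That the outer integrand is integrable in time is part of the definition. -/
def IsVelocityField {E : Type*} [MeasurableSpace E] [NormedAddCommGroup E] [NormedSpace ℝ E]
    (p : ℝ) (μ : ℝ → Measure E) (v : ℝ → E → E) : Prop :=
  (∀ᵐ t ∂(volume.restrict (Icc (0 : ℝ) 1)), MemLp (v t) (ENNReal.ofReal p) (μ t)) ∧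
    ∀ φ : E → ℝ, ContDiff ℝ 1 φ → HasCompactSupport φ →
      IntegrableOn (fun s => ∫ x, fderiv ℝ φ x (v s x) ∂(μ s)) (Icc (0 : ℝ) 1) volume ∧
        ∀ t₁ ∈ Icc (0 : ℝ) 1, ∀ t₂ ∈ Icc (0 : ℝ) 1, t₁ < t₂ →
          ∫ x, φ x ∂(μ t₂) - ∫ x, φ x ∂(μ t₁)
            = ∫ s in t₁..t₂, ∫ x, fderiv ℝ φ x (v s x) ∂(μ s)

/-- Smoothness (`C^∞`) of a function on a set which need not be open: the function agrees with
a smooth function defined on an open neighbourhood of the set. The function `f` itself is taken to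
be that function, so that its derivatives at points of the set are the usual ones. -/
def IsSmoothOn {F G : Type*} [NormedAddCommGroup F] [NormedSpace ℝ F]
    [NormedAddCommGroup G] [NormedSpace ℝ G] (f : F → G) (s : Set F) : Prop :=
  ∃ U : Set F, IsOpen U ∧ s ⊆ U ∧ ContDiffOn ℝ ∞ f U

/-- `f` restricts to a diffeomorphism of `Ω` onto itself. -/
def IsDiffeoOn {E : Type*} [NormedAddCommGroup E] [NormedSpace ℝ E]
    (f : E → E) (Ω : Set E) : Prop :=
  IsSmoothOn f Ω ∧ MapsTo f Ω Ω ∧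
    ∃ g : E → E, IsSmoothOn g Ω ∧ MapsTo g Ω Ω ∧ InvOn g f Ω Ω

/-- The field `∇T_t · v_t + ∂T/∂t` at time `t` and at the point `x`. -/
noncomputable def transportedVelocity {E : Type*} [NormedAddCommGroup E] [NormedSpace ℝ E]
    (T : ℝ → E → E) (v : ℝ → E → E) (t : ℝ) (x : E) : E :=
  fderiv ℝ (T t) x (v t x) + deriv (fun s => T s x) t

/-- The identity of vector measures `v'_t · μ'_t = (T_t)♯[(∇T_t · v_t + ∂T/∂t) μ_t]` on `Ω`, where
`μ'_t = (T_t)♯μ_t`, for a.e. `t ∈ [0, 1]`: both sides give the same vector to every Borel set.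
(As for `v_t`, it is understood for a.e. `t`.) -/
def IsPushforwardField {E : Type*} [MeasurableSpace E] [NormedAddCommGroup E] [NormedSpace ℝ E]
    (Ω : Set E) (μ : ℝ → Measure E) (T : ℝ → E → E) (v v' : ℝ → E → E) : Prop :=
  ∀ᵐ t ∂(volume.restrict (Icc (0 : ℝ) 1)),
    Integrable (transportedVelocity T v t) (μ t) ∧ Integrable (v' t) ((μ t).map (T t)) ∧
      ∀ A : Set E, MeasurableSet A →
        ∫ y in A, v' t y ∂((μ t).map (T t))
          = ∫ x in Ω ∩ T t ⁻¹' A, transportedVelocity T v t x ∂(μ t)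

/-! The transported curve is Lipschitz because a coupling of `μ s` and `μ t`, pushed forward by `(T
s, T t)`, couples the two images. Its cost is controlled by the Lipschitz constant of `T s` and by
the displacement between `T s` and `T t`, which the growth bound makes of order `|s - t|` in `Lᵖ`,
the `p`-th moments being bounded along the curve (`wassersteinDist_map_le`). As `T t` is invertible
on `Ω`, the field is forced: `v' t` is a.e. the field `∇T_t · v_t + ∂T/∂t` composed with the inverse
of `T t`.

For the continuity equation, a test function `φ` is pulled back to `φ (T t x)`, whose derivative in
the direction `(1, v)` is the derivative of `φ` at `T t x` applied to the transported velocity. Two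
points need care. The pullback depends on time, whereas the definition tests only against fixed
functions; `IsVelocityField.integral_slice_sub` removes this restriction by showing that `t ↦ ∫ Ψ(t,
·) dμ_t` is Lipschitz and computing its derivative at a.e. time as in the product rule. The pullback
must also be compactly supported although `Ω` may be unbounded:
`exists_forall_norm_le_of_norm_apply_le` shows that the maps `T t` are proper uniformly in time, so
a cut-off yields a genuine test function on space-time (`exists_testFunction_comp`). -/

/-! ### Couplings and estimates for the Wasserstein distance -/

section Coupling

variable {E : Type*} [MeasurableSpace E]

theorem IsCoupling.isProbabilityMeasure {π : Measure (E × E)} {μ ν : Measure E}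
    [IsProbabilityMeasure μ] (h : IsCoupling π μ ν) : IsProbabilityMeasure π := by
  constructor
  have := congrArg (fun m => m univ) h.1
  simpa [Measure.map_apply measurable_fst MeasurableSet.univ] using this

theorem IsCoupling.ae_fst {π : Measure (E × E)} {μ ν : Measure E} (h : IsCoupling π μ ν)
    {P : E → Prop} (hP : ∀ᵐ x ∂μ, P x) : ∀ᵐ z ∂π, P z.1 :=
  ae_of_ae_map measurable_fst.aemeasurable (h.1 ▸ hP)

theorem IsCoupling.ae_snd {π : Measure (E × E)} {μ ν : Measure E} (h : IsCoupling π μ ν)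
    {P : E → Prop} (hP : ∀ᵐ x ∂ν, P x) : ∀ᵐ z ∂π, P z.2 :=
  ae_of_ae_map measurable_snd.aemeasurable (h.2 ▸ hP)

theorem IsCoupling.map {π : Measure (E × E)} {μ ν : Measure E} (h : IsCoupling π μ ν)
    {f g : E → E} (hf : AEMeasurable f μ) (hg : AEMeasurable g ν) :
    IsCoupling (π.map fun z => (f z.1, g z.2)) (μ.map f) (ν.map g) := by
  have hf' : AEMeasurable (fun z : E × E => f z.1) π :=
    AEMeasurable.comp_measurable (by rwa [h.1]) measurable_fst
  have hg' : AEMeasurable (fun z : E × E => g z.2) π :=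
    AEMeasurable.comp_measurable (by rwa [h.2]) measurable_snd
  constructor
  · rw [AEMeasurable.map_map_of_aemeasurable measurable_fst.aemeasurable (hf'.prodMk hg'),
      ← h.1, AEMeasurable.map_map_of_aemeasurable (by rwa [h.1]) measurable_fst.aemeasurable]
    rfl
  · rw [AEMeasurable.map_map_of_aemeasurable measurable_snd.aemeasurable (hf'.prodMk hg'),
      ← h.2, AEMeasurable.map_map_of_aemeasurable (by rwa [h.2]) measurable_snd.aemeasurable]
    rfl

theorem IsCoupling.wassersteinDist_le [PseudoEMetricSpace E] {p : ℝ} (hp : 0 < p)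
    {π : Measure (E × E)} {μ ν : Measure E} (h : IsCoupling π μ ν) :
    wassersteinDist p μ ν ≤ (∫⁻ z, edist z.1 z.2 ^ p ∂π) ^ (1 / p) :=
  ENNReal.rpow_le_rpow (iInf₂_le π h) (by positivity)

theorem exists_coupling_of_wassersteinDist_lt [PseudoEMetricSpace E] {p : ℝ} (hp : 0 < p)
    {μ ν : Measure E} {a : ℝ≥0∞} (h : wassersteinDist p μ ν < a) :
    ∃ π, IsCoupling π μ ν ∧ (∫⁻ z, edist z.1 z.2 ^ p ∂π) ^ (1 / p) < a := by
  unfold wassersteinDist at h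
  rw [one_div, ENNReal.rpow_inv_lt_iff hp] at h
  simp only [iInf_lt_iff] at h
  obtain ⟨π, hπ, hlt⟩ := h
  exact ⟨π, hπ, by rwa [one_div, ENNReal.rpow_inv_lt_iff hp]⟩

/-- To bound a quantity by an affine function of the Wasserstein distance, it suffices to bound it
in terms of the cost of every coupling. -/
theorem le_add_mul_wassersteinDist_of_forall_coupling [PseudoEMetricSpace E] {p : ℝ} (hp : 0 < p)
    {μ ν : Measure E} {K b c : ℝ≥0∞} (hK : K ≠ ⊤) (hW : wassersteinDist p μ ν ≠ ⊤)
    (h : ∀ π, IsCoupling π μ ν → c ≤ b + K * (∫⁻ z, edist z.1 z.2 ^ p ∂π) ^ (1 / p)) :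
    c ≤ b + K * wassersteinDist p μ ν := by
  -- The bound holds for every `a` above the distance, since some coupling has cost below `a`;
  -- letting `a` decrease avoids the existence of optimal couplings.
  have hcont : ContinuousWithinAt (fun a => b + K * a) (Ioi (wassersteinDist p μ ν))
      (wassersteinDist p μ ν) :=
    ((ENNReal.continuous_const_mul hK).const_add b).continuousWithinAt
  have : (nhdsWithin (wassersteinDist p μ ν) (Ioi (wassersteinDist p μ ν))).NeBot :=
    nhdsGT_neBot_of_exists_gt ⟨⊤, lt_top_iff_ne_top.2 hW⟩
  refine ge_of_tendsto hcont ?_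
  filter_upwards [self_mem_nhdsWithin] with a ha
  obtain ⟨π, hπ, hlt⟩ := exists_coupling_of_wassersteinDist_lt hp ha
  exact (h π hπ).trans (by gcongr)

/-- On a probability space the `L¹` norm is at most the `Lᵖ` norm, for `ℝ≥0∞`-valued functions. -/
theorem lintegral_le_rpow_lintegral_rpow {α : Type*} [MeasurableSpace α] {μ : Measure α}
    [IsProbabilityMeasure μ] {p : ℝ} (hp : 1 ≤ p) {f : α → ℝ≥0∞} (hf : AEMeasurable f μ) :
    ∫⁻ x, f x ∂μ ≤ (∫⁻ x, f x ^ p ∂μ) ^ (1 / p) := by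
  have := eLpNorm'_le_eLpNorm'_of_exponent_le one_pos hp μ hf.aestronglyMeasurable
  simpa [eLpNorm'] using this

/-- The easy half of Kantorovich duality: integrals of `K`-Lipschitz functions are `K`-Lipschitz
for the Wasserstein distance. -/
theorem LipschitzWith.edist_integral_le_mul_wassersteinDist [PseudoEMetricSpace E]
    [OpensMeasurableSpace E] [SecondCountableTopology E] {p : ℝ} (hp : 1 ≤ p)
    {μ ν : Measure E} [IsProbabilityMeasure μ] [IsProbabilityMeasure ν]
    (hW : wassersteinDist p μ ν ≠ ⊤) {K : ℝ≥0} {f : E → ℝ} (hf : LipschitzWith K f)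
    (hμ : Integrable f μ) (hν : Integrable f ν) :
    edist (∫ x, f x ∂μ) (∫ x, f x ∂ν) ≤ K * wassersteinDist p μ ν := by
  rw [← zero_add (_ * _)]
  refine le_add_mul_wassersteinDist_of_forall_coupling (by linarith) (by simp) hW fun π hπ => ?_
  rw [zero_add]
  have := hπ.isProbabilityMeasure
  have h1 : Integrable (fun z : E × E => f z.1) π :=
    Integrable.comp_measurable (by rwa [hπ.1]) measurable_fst
  have h2 : Integrable (fun z : E × E => f z.2) π :=
    Integrable.comp_measurable (by rwa [hπ.2]) measurable_snd
  have e1 : ∫ x, f x ∂μ = ∫ z, f z.1 ∂π := by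
    rw [← hπ.1, integral_map measurable_fst.aemeasurable (by rw [hπ.1]; exact hμ.1)]
  have e2 : ∫ x, f x ∂ν = ∫ z, f z.2 ∂π := by
    rw [← hπ.2, integral_map measurable_snd.aemeasurable (by rw [hπ.2]; exact hν.1)]
  rw [e1, e2, edist_eq_enorm_sub, ← integral_sub h1 h2]
  calc ‖∫ z, (f z.1 - f z.2) ∂π‖ₑ ≤ ∫⁻ z, ‖f z.1 - f z.2‖ₑ ∂π := enorm_integral_le_lintegral_enorm _
    _ ≤ ∫⁻ z, K * edist z.1 z.2 ∂π := by
        refine lintegral_mono fun z => ?_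
        rw [← edist_eq_enorm_sub]
        exact hf z.1 z.2
    _ = K * ∫⁻ z, edist z.1 z.2 ∂π := lintegral_const_mul _ (by fun_prop)
    _ ≤ K * (∫⁻ z, edist z.1 z.2 ^ p ∂π) ^ (1 / p) := by
        gcongr
        exact lintegral_le_rpow_lintegral_rpow hp (by fun_prop)

variable [NormedAddCommGroup E] [OpensMeasurableSpace E] [SecondCountableTopology E]

/-- Minkowski's inequality in `Lᵖ(π)` for a coupling `π`. It serves to bound the moments uniformly
along a Lipschitz curve. -/
theorem rpow_lintegral_enorm_le_add_wassersteinDist {p : ℝ} (hp : 1 ≤ p)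
    {μ ν : Measure E} (hW : wassersteinDist p μ ν ≠ ⊤) :
    (∫⁻ x, ‖x‖ₑ ^ p ∂ν) ^ (1 / p) ≤
      (∫⁻ x, ‖x‖ₑ ^ p ∂μ) ^ (1 / p) + wassersteinDist p μ ν := by
  have hp0 : 0 < p := by linarith
  rw [← one_mul (wassersteinDist _ _ _)]
  refine le_add_mul_wassersteinDist_of_forall_coupling hp0 (by simp) hW fun π hπ => ?_
  rw [one_mul]
  have e1 : ∫⁻ x, ‖x‖ₑ ^ p ∂μ = ∫⁻ z, ‖z.1‖ₑ ^ p ∂π := by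
    rw [← hπ.1, lintegral_map (by fun_prop) measurable_fst]
  have e2 : ∫⁻ x, ‖x‖ₑ ^ p ∂ν = ∫⁻ z, ‖z.2‖ₑ ^ p ∂π := by
    rw [← hπ.2, lintegral_map (by fun_prop) measurable_snd]
  rw [e1, e2]
  refine le_trans ?_ (ENNReal.lintegral_Lp_add_le (by fun_prop) (by fun_prop) hp)
  gcongr with z
  rw [Pi.add_apply, ← edist_zero_right, ← edist_zero_right, add_comm, edist_comm z.1 z.2]
  exact edist_triangle _ _ _

/-- The Wasserstein distance between the images of two measures under two maps, one of which is
Lipschitz, which are close to each other. -/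
theorem wassersteinDist_map_le {p : ℝ} (hp : 1 ≤ p) {Ω : Set E}
    {μ ν : Measure E} [IsProbabilityMeasure ν] (hμΩ : μ Ωᶜ = 0) (hνΩ : ν Ωᶜ = 0)
    (hW : wassersteinDist p μ ν ≠ ⊤) {f g : E → E} (hf : AEMeasurable f μ) (hg : AEMeasurable g ν)
    {K δ : ℝ≥0} (hK : LipschitzOnWith K f Ω)
    (hδ : ∀ y ∈ Ω, edist (f y) (g y) ≤ δ * (1 + ‖y‖ₑ)) :
    wassersteinDist p (μ.map f) (ν.map g) ≤
      δ * (1 + (∫⁻ y, ‖y‖ₑ ^ p ∂ν) ^ (1 / p)) + K * wassersteinDist p μ ν := by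
  have hp0 : 0 < p := by linarith
  refine le_add_mul_wassersteinDist_of_forall_coupling hp0 (by simp) hW fun π hπ => ?_
  refine ((hπ.map hf hg).wassersteinDist_le hp0).trans ?_
  have hf' : AEMeasurable (fun z : E × E => f z.1) π :=
    AEMeasurable.comp_measurable (by rwa [hπ.1]) measurable_fst
  have hg' : AEMeasurable (fun z : E × E => g z.2) π :=
    AEMeasurable.comp_measurable (by rwa [hπ.2]) measurable_snd
  rw [lintegral_map' (by fun_prop) (hf'.prodMk hg')]
  have e2 : ∀ F : E → ℝ≥0∞, Measurable F → ∫⁻ x, F x ∂ν = ∫⁻ z, F z.2 ∂π := fun F hF => by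
    rw [← hπ.2, lintegral_map hF measurable_snd]
  have hconst (c : ℝ≥0) {F : E × E → ℝ≥0∞} (hF : Measurable F) :
      (∫⁻ z, (c * F z) ^ p ∂π) ^ (1 / p) = c * (∫⁻ z, F z ^ p ∂π) ^ (1 / p) := by
    simp_rw [ENNReal.mul_rpow_of_nonneg _ _ hp0.le]
    rw [lintegral_const_mul _ (by fun_prop), ENNReal.mul_rpow_of_nonneg _ _ (by positivity),
      ← ENNReal.rpow_mul, mul_one_div_cancel hp0.ne', ENNReal.rpow_one]
  -- The triangle inequality through `f z.2` isolates the displacement from `f` to `g`; Minkowski's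
  -- inequality then separates the two costs.
  calc (∫⁻ z, edist (f z.1) (g z.2) ^ p ∂π) ^ (1 / p)
      ≤ (∫⁻ z, ((fun z : E × E => δ * (1 + ‖z.2‖ₑ)) + fun z : E × E => K * edist z.1 z.2) z ^ p ∂π)
          ^ (1 / p) := by
        refine ENNReal.rpow_le_rpow (lintegral_mono_ae ?_) (by positivity)
        filter_upwards [hπ.ae_fst hμΩ, hπ.ae_snd hνΩ] with z h1 h2
        refine ENNReal.rpow_le_rpow ?_ hp0.le
        rw [Pi.add_apply, add_comm]
        exact (edist_triangle _ (f z.2) _).trans (add_le_add (hK h1 h2) (hδ _ h2))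
    _ ≤ (∫⁻ z, (δ * (1 + ‖z.2‖ₑ)) ^ p ∂π) ^ (1 / p)
          + (∫⁻ z, (K * edist z.1 z.2) ^ p ∂π) ^ (1 / p) :=
        ENNReal.lintegral_Lp_add_le (f := fun z : E × E => δ * (1 + ‖z.2‖ₑ))
          (g := fun z : E × E => K * edist z.1 z.2) (by fun_prop) (by fun_prop) hp
    _ = δ * (∫⁻ z, (1 + ‖z.2‖ₑ) ^ p ∂π) ^ (1 / p)
          + K * (∫⁻ z, edist z.1 z.2 ^ p ∂π) ^ (1 / p) := by
        rw [hconst δ (F := fun z => 1 + ‖z.2‖ₑ) (by fun_prop), hconst K (by fun_prop)]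
    _ ≤ _ := by
        gcongr
        rw [← e2 (fun y => (1 + ‖y‖ₑ) ^ p) (by fun_prop)]
        refine (ENNReal.lintegral_Lp_add_le (f := fun _ => 1) (by fun_prop)
          (by fun_prop) hp).trans_eq ?_
        simp

end Coupling

/-! ### Continuity in time of integrals along a Lipschitz curve -/

section Curve

open Filter Topology

variable {E : Type*} [NormedAddCommGroup E] [MeasurableSpace E] [BorelSpace E]
  [SecondCountableTopology E] {p : ℝ} {Ω : Set E} {μ : ℝ → Measure E}

/-- Along a Lipschitz curve, the integrals of bounded Lipschitz functions are Lipschitz in time. -/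
theorem IsLipschitzCurve.exists_lipschitzOnWith_integral (hp : 1 ≤ p)
    (hμ : IsLipschitzCurve p Ω μ) :
    ∃ L : ℝ≥0, ∀ (K : ℝ≥0) (φ : E → ℝ), LipschitzWith K φ → (∃ C, ∀ x, ‖φ x‖ ≤ C) →
      LipschitzOnWith (K * L) (fun t => ∫ x, φ x ∂μ t) (Icc 0 1) := by
  obtain ⟨hmem, L, hL⟩ := hμ
  refine ⟨L, fun K φ hK ⟨C, hC⟩ s hs t ht => ?_⟩
  have := (hmem s hs).1
  have := (hmem t ht).1
  have hint (r : ℝ) (_ : IsProbabilityMeasure (μ r)) : Integrable φ (μ r) :=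
    Integrable.of_bound hK.continuous.aestronglyMeasurable C (ae_of_all _ hC)
  have hW : wassersteinDist p (μ s) (μ t) ≠ ⊤ :=
    ne_top_of_le_ne_top (ENNReal.mul_ne_top (by simp) (edist_ne_top _ _)) (hL s hs t ht)
  calc _ ≤ K * wassersteinDist p (μ s) (μ t) :=
        hK.edist_integral_le_mul_wassersteinDist hp hW (hint s ‹_›) (hint t ‹_›)
    _ ≤ K * (L * edist s t) := by gcongr; exact hL s hs t ht
    _ = _ := by push_cast; ring

/-- A Lipschitz curve is narrowly continuous. -/
theorem IsLipschitzCurve.continuousOn_integral (hp : 1 ≤ p) (hμ : IsLipschitzCurve p Ω μ)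
    {f : E → ℝ} (hf : Continuous f) {C : ℝ} (hC : ∀ x, ‖f x‖ ≤ C) :
    ContinuousOn (fun t => ∫ x, f x ∂μ t) (Icc 0 1) := by
  obtain ⟨L, hL⟩ := hμ.exists_lipschitzOnWith_integral hp
  let P : Icc (0 : ℝ) 1 → ProbabilityMeasure E := fun t => ⟨μ t, (hμ.1 t t.2).1⟩
  rw [continuousOn_iff_continuous_domRestrict, continuous_iff_continuousAt]
  intro t
  -- Bounded Lipschitz functions suffice to test narrow convergence.
  have hP : Tendsto P (𝓝 t) (𝓝 (P t)) := by
    rw [tendsto_iff_forall_lipschitz_integral_tendsto]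
    rintro φ ⟨C', hC'⟩ ⟨K, hK⟩
    have hb : ∃ C, ∀ x, ‖φ x‖ ≤ C := by
      refine ⟨C' + ‖φ 0‖, fun x => ?_⟩
      have := hC' x 0
      rw [dist_eq_norm] at this
      linarith [norm_le_norm_sub_add (φ x) (φ 0)]
    exact (continuousOn_iff_continuous_domRestrict.1 (hL K φ hK hb).continuousOn).continuousAt
  rw [ProbabilityMeasure.tendsto_iff_forall_integral_tendsto] at hP
  exact hP (BoundedContinuousFunction.ofNormedAddCommGroup f hf C hC)

end Curve

/-! ### Uniform estimates for test functions on space-time -/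

section TestFunctions

open Filter Topology

/-- A three-epsilon argument. It passes from rational time slices of a test function to all slices.
-/
theorem hasDerivAt_of_approx {f : ℝ → ℝ} {a t : ℝ}
    (h : ∀ ε > 0, ∃ (g : ℝ → ℝ) (b : ℝ), HasDerivAt g b t ∧ |b - a| ≤ ε ∧
      ∀ᶠ s in 𝓝 t, |(f s - f t) - (g s - g t)| ≤ ε * |s - t|) : HasDerivAt f a t := by
  rw [hasDerivAt_iff_isLittleO, Asymptotics.isLittleO_iff]
  intro c hc
  obtain ⟨g, b, hg, hb, hfg⟩ := h (c / 3) (by positivity)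
  rw [hasDerivAt_iff_isLittleO, Asymptotics.isLittleO_iff] at hg
  filter_upwards [hfg, hg (c := c / 3) (by positivity)] with s h1 h2
  simp only [Real.norm_eq_abs, smul_eq_mul] at h2 ⊢
  have h3 : |(s - t) * (b - a)| ≤ c / 3 * |s - t| := by
    rw [abs_mul, mul_comm]; gcongr
  calc |f s - f t - (s - t) * a|
      = |((f s - f t) - (g s - g t)) + (g s - g t - (s - t) * b) + (s - t) * (b - a)| := by
        congr 1; ring
    _ ≤ _ := (abs_add_three _ _ _)
    _ ≤ c * |s - t| := by linarith

theorem HasCompactSupport.slice {E : Type*} [TopologicalSpace E] [T2Space E] {Ψ : ℝ × E → ℝ}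
    (hΨ : HasCompactSupport Ψ) (t : ℝ) :
    HasCompactSupport fun x => Ψ (t, x) :=
  HasCompactSupport.intro (IsCompact.image hΨ continuous_snd) fun x hx =>
    image_eq_zero_of_notMem_tsupport fun h => hx ⟨(t, x), h, rfl⟩

variable {E : Type*} [NormedAddCommGroup E] [NormedSpace ℝ E] {Ψ : ℝ × E → ℝ}

theorem ContDiff.slice {n : WithTop ℕ∞} (hΨ : ContDiff ℝ n Ψ) (t : ℝ) :
    ContDiff ℝ n fun x => Ψ (t, x) :=
  hΨ.comp (contDiff_prodMk_right t)

theorem fderiv_slice (hΨ : ContDiff ℝ 1 Ψ) (t : ℝ) (x w : E) :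
    fderiv ℝ (fun x => Ψ (t, x)) x w = fderiv ℝ Ψ (t, x) (0, w) := by
  have := ((hΨ.differentiable one_ne_zero).differentiableAt (x := (t, x))).hasFDerivAt.comp x
    (hasFDerivAt_prodMk_right t x)
  rw [show (fun x => Ψ (t, x)) = Ψ ∘ fun x => (t, x) from rfl, this.fderiv]
  simp

theorem exists_forall_norm_fderiv_sub_le (hΨ : ContDiff ℝ 1 Ψ) (hc : HasCompactSupport Ψ) {ε : ℝ}
    (hε : 0 < ε) :
    ∃ δ > 0, ∀ s t x y, dist s t < δ → dist x y < δ →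
      ‖fderiv ℝ Ψ (s, x) - fderiv ℝ Ψ (t, y)‖ ≤ ε := by
  have huc := (hc.fderiv ℝ).uniformContinuous_of_continuous (hΨ.continuous_fderiv one_ne_zero)
  obtain ⟨δ, hδ, h⟩ := Metric.uniformContinuous_iff.1 huc ε hε
  refine ⟨δ, hδ, fun s t x y h1 h2 => ?_⟩
  rw [← dist_eq_norm]
  exact (h (by rw [Prod.dist_eq]; exact max_lt h1 h2)).le

/-- The compactly supported derivative of `Ψ` is uniformly continuous, so nearby slices have close
gradients. Closeness in the Lipschitz seminorm, rather than in the supremum norm, is what a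
Lipschitz curve converts into increments of order `|s - t|`. -/
theorem exists_forall_lipschitzWith_slice_sub (hΨ : ContDiff ℝ 1 Ψ) (hc : HasCompactSupport Ψ)
    {ε : ℝ≥0} (hε : 0 < ε) :
    ∃ δ > 0, ∀ s t, dist s t < δ → LipschitzWith ε fun x => Ψ (s, x) - Ψ (t, x) := by
  obtain ⟨δ, hδ, h⟩ := exists_forall_norm_fderiv_sub_le hΨ hc (NNReal.coe_pos.2 hε)
  refine ⟨δ, hδ, fun s t hst => ?_⟩
  have hd (r : ℝ) : Differentiable ℝ fun x => Ψ (r, x) := (hΨ.slice r).differentiable one_ne_zero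
  refine lipschitzWith_of_nnnorm_fderiv_le ((hd s).sub (hd t)) fun x => ?_
  rw [← NNReal.coe_le_coe, coe_nnnorm]
  refine ContinuousLinearMap.opNorm_le_bound _ ε.2 fun w => ?_
  rw [fderiv_fun_sub (hd s x) (hd t x), sub_apply, fderiv_slice hΨ,
    fderiv_slice hΨ, ← sub_apply]
  refine (ContinuousLinearMap.le_of_opNorm_le _ (h s t x x hst (by simpa)) _).trans_eq ?_
  simp [Prod.norm_def]

/-- The mean value inequality in the time direction; its uniformity in `x` allows integration
against the moving measure `μ s`. -/
theorem exists_forall_norm_sub_sub_le (hΨ : ContDiff ℝ 1 Ψ) (hc : HasCompactSupport Ψ) {ε : ℝ}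
    (hε : 0 < ε) :
    ∃ δ > 0, ∀ s t x, dist s t < δ →
      ‖Ψ (s, x) - Ψ (t, x) - (s - t) * fderiv ℝ Ψ (t, x) (1, 0)‖ ≤ ε * |s - t| := by
  obtain ⟨δ, hδ, h⟩ := exists_forall_norm_fderiv_sub_le hΨ hc hε
  refine ⟨δ, hδ, fun s t x hst => ?_⟩
  have := (convex_ball (t, x) δ).norm_image_sub_le_of_norm_fderiv_le' (𝕜 := ℝ) (f := Ψ)
    (φ := fderiv ℝ Ψ (t, x)) (C := ε) (x := (t, x)) (y := (s, x))
    (fun z _ => hΨ.differentiable one_ne_zero z) (fun z hz => ?_) (Metric.mem_ball_self hδ)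
    (by simpa [Prod.dist_eq, hδ] using hst)
  · have e : ((s, x) : ℝ × E) - (t, x) = (s - t) • (1, 0) := by simp
    rw [e, map_smul, smul_eq_mul] at this
    refine this.trans_eq ?_
    simp [Prod.norm_def]
  · rw [Metric.mem_ball, Prod.dist_eq, max_lt_iff] at hz
    exact h _ _ _ _ hz.1 hz.2

end TestFunctions

/-! ### The continuity equation for time-dependent test functions -/

section TimeDependent

open Filter Topology

variable {E : Type*} [NormedAddCommGroup E] [NormedSpace ℝ E] [MeasurableSpace E]
  {p : ℝ} {Ω : Set E} {μ : ℝ → Measure E} {v : ℝ → E → E}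

theorem ae_restrict_Icc_mem_Ioo : ∀ᵐ t ∂volume.restrict (Icc (0 : ℝ) 1), t ∈ Ioo (0 : ℝ) 1 := by
  rw [← restrict_Ioo_eq_restrict_Icc]
  exact ae_restrict_mem measurableSet_Ioo

/-- Lebesgue differentiation of the continuity equation tested against a fixed function. -/
theorem IsVelocityField.ae_hasDerivAt (hv : IsVelocityField p μ v) {φ : E → ℝ}
    (hφ : ContDiff ℝ 1 φ) (hc : HasCompactSupport φ) :
    ∀ᵐ t ∂volume.restrict (Icc (0 : ℝ) 1),
      HasDerivAt (fun s => ∫ x, φ x ∂μ s) (∫ x, fderiv ℝ φ x (v t x) ∂μ t) t := by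
  obtain ⟨hint, heq⟩ := hv.2 φ hφ hc
  have hI : IntervalIntegrable (fun s => ∫ x, fderiv ℝ φ x (v s x) ∂μ s) volume 0 1 := by
    rw [intervalIntegrable_iff_integrableOn_Icc_of_le zero_le_one]; exact hint
  filter_upwards [ae_restrict_of_ae hI.ae_hasDerivAt_integral, ae_restrict_Icc_mem_Ioo] with t ht htI
  rw [uIcc_of_le zero_le_one] at ht
  have h := (ht (Ioo_subset_Icc_self htI) 0 (by simp)).const_add (∫ x, φ x ∂μ 0)
  refine h.congr_of_eventuallyEq ?_
  filter_upwards [Ioo_mem_nhds htI.1 htI.2] with s hs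
  rw [← heq 0 (by simp) s (Ioo_subset_Icc_self hs) hs.1]
  ring

variable [BorelSpace E] [SecondCountableTopology E] {Ψ : ℝ × E → ℝ}

theorem integrable_fderiv_slice_apply (hΨ : ContDiff ℝ 1 Ψ) (hc : HasCompactSupport Ψ)
    {ν : Measure E} [IsFiniteMeasure ν] (s c : ℝ) {w : E → E} (hw : Integrable w ν) :
    Integrable (fun x => fderiv ℝ Ψ (s, x) (c, w x)) ν := by
  obtain ⟨B, hB⟩ := (hc.fderiv ℝ).exists_bound_of_continuous (hΨ.continuous_fderiv one_ne_zero)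
  have hp : Integrable (fun x => (c, w x)) ν := (integrable_const c).prodMk hw
  refine (hp.norm.const_mul B).mono' ?_
    (ae_of_all _ fun x => ContinuousLinearMap.le_of_opNorm_le _ (hB (s, x)) _)
  have h1 : AEStronglyMeasurable (fun x => fderiv ℝ Ψ (s, x)) ν :=
    ((hΨ.continuous_fderiv one_ne_zero).comp (Continuous.prodMk_right s)).aestronglyMeasurable
  exact (isBoundedBilinearMap_apply (𝕜 := ℝ) (E := ℝ × E) (F := ℝ)).continuous
    |>.comp_aestronglyMeasurable (h1.prodMk hp.1)

/-- For almost every time `t`, the continuity equation can be differentiated at `t` against all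
the time slices of a test function on space-time, including the slice at time `t` itself. -/
theorem IsVelocityField.ae_hasDerivAt_slice (hp : 1 ≤ p) (hμ : IsLipschitzCurve p Ω μ)
    (hv : IsVelocityField p μ v) (hΨ : ContDiff ℝ 1 Ψ) (hc : HasCompactSupport Ψ) :
    ∀ᵐ t ∂volume.restrict (Icc (0 : ℝ) 1),
      HasDerivAt (fun s => ∫ x, Ψ (t, x) ∂μ s) (∫ x, fderiv ℝ Ψ (t, x) (0, v t x) ∂μ t) t := by
  obtain ⟨L, hL⟩ := hμ.exists_lipschitzOnWith_integral hp
  obtain ⟨B, hB⟩ := hc.exists_bound_of_continuous hΨ.continuous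
  -- The exceptional null set depends on the test function, but the countably many rational slices
  -- share one. The slice at `t` is then approximated by rational slices.
  have hq : ∀ᵐ t ∂volume.restrict (Icc (0 : ℝ) 1), ∀ q : ℚ,
      HasDerivAt (fun s => ∫ x, Ψ (q, x) ∂μ s) (∫ x, fderiv ℝ Ψ (q, x) (0, v t x) ∂μ t) t := by
    rw [ae_all_iff]
    intro q
    simpa only [fderiv_slice hΨ] using hv.ae_hasDerivAt (hΨ.slice q) (hc.slice q)
  filter_upwards [hq, hv.1, ae_restrict_Icc_mem_Ioo] with t hq hvt htI
  have hprob := (hμ.1 t (Ioo_subset_Icc_self htI)).1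
  have hvi : Integrable (v t) (μ t) := hvt.integrable (ENNReal.one_le_ofReal.2 hp)
  have hi (s : ℝ) : Integrable (fun x => fderiv ℝ Ψ (s, x) (0, v t x)) (μ t) :=
    integrable_fderiv_slice_apply hΨ hc s 0 hvi
  -- `L` governs the error on increments and the `L¹` norm of `v t` the error on derivatives; the
  -- `1` makes `N` positive.
  set N : ℝ := L + ∫ x, ‖v t x‖ ∂μ t + 1 with hN
  have hN0 : 0 ≤ ∫ x, ‖v t x‖ ∂μ t := integral_nonneg fun _ => norm_nonneg _
  have hNpos : 0 < N := by positivity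
  refine hasDerivAt_of_approx fun ε hε => ?_
  lift ε to ℝ≥0 using hε.le
  lift N to ℝ≥0 using hNpos.le with N'
  have hε' : 0 < ε / N' := div_pos (NNReal.coe_pos.1 hε) (NNReal.coe_pos.1 hNpos)
  have hmul : (ε / N' : ℝ≥0) * (N' : ℝ) = ε := by
    rw [← NNReal.coe_mul, div_mul_cancel₀ _ (NNReal.coe_pos.1 hNpos).ne']
  obtain ⟨δ₁, hδ₁, h1⟩ := exists_forall_norm_fderiv_sub_le hΨ hc (NNReal.coe_pos.2 hε')
  obtain ⟨δ₂, hδ₂, h2⟩ := exists_forall_lipschitzWith_slice_sub hΨ hc hε'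
  obtain ⟨q, hqt, hqt'⟩ := exists_rat_btwn (show t < t + min δ₁ δ₂ by simp [hδ₁, hδ₂])
  have hd : dist (q : ℝ) t < min δ₁ δ₂ := by
    rw [Real.dist_eq, abs_of_pos (by linarith)]; linarith
  refine ⟨_, _, hq q, ?_, ?_⟩
  · rw [← integral_sub (hi q) (hi t), ← Real.norm_eq_abs]
    calc _ ≤ ∫ x, (ε / N' : ℝ≥0) * ‖v t x‖ ∂μ t := by
          refine norm_integral_le_of_norm_le (hvi.norm.const_mul _) (ae_of_all _ fun x => ?_)
          rw [← sub_apply (fderiv ℝ Ψ (q, x))]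
          refine (ContinuousLinearMap.le_of_opNorm_le _
            (h1 q t x x (hd.trans_le (min_le_left _ _)) (by simpa)) _).trans_eq ?_
          simp [Prod.norm_def]
      _ = (ε / N' : ℝ≥0) * ∫ x, ‖v t x‖ ∂μ t := integral_const_mul _ _
      _ ≤ (ε / N' : ℝ≥0) * N' := by
          gcongr; rw [hN]; linarith [L.2]
      _ = ε := hmul
  · have hlip := hL (ε / N') _ (h2 t q (by
      rw [dist_comm]; exact hd.trans_le (min_le_right _ _)))
      ⟨B + B, fun x => (norm_sub_le _ _).trans (add_le_add (hB _) (hB _))⟩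
    filter_upwards [Ioo_mem_nhds htI.1 htI.2] with s hs
    have hbi (r a : ℝ) (hr : r ∈ Ioo (0 : ℝ) 1) : Integrable (fun x => Ψ (a, x)) (μ r) := by
      have := (hμ.1 r (Ioo_subset_Icc_self hr)).1
      exact Integrable.of_bound (hΨ.continuous.comp
        (Continuous.prodMk_right a)).aestronglyMeasurable B (ae_of_all _ fun x => hB _)
    have := hlip.dist_le_mul s (Ioo_subset_Icc_self hs) t (Ioo_subset_Icc_self htI)
    simp only [Real.dist_eq] at this
    rw [integral_sub (hbi s t hs) (hbi s q hs), integral_sub (hbi t t htI) (hbi t q htI)] at this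
    rw [show ∀ a b c d : ℝ, a - b - (c - d) = a - c - (b - d) by intros; ring]
    refine this.trans ?_
    gcongr
    have hLN : L ≤ N' := by rw [← NNReal.coe_le_coe, hN]; linarith
    calc ε / N' * L ≤ ε / N' * N' := by gcongr
      _ = ε := by exact_mod_cast hmul

/-- The integral vanishes at `s = t`, and near `t` it is `s - t` times the integral of the time
derivative against `μ s`, up to a uniform `o(s - t)`. Narrow continuity replaces `μ s` by `μ t`. -/
theorem IsLipschitzCurve.hasDerivAt_integral_sub (hp : 1 ≤ p) (hμ : IsLipschitzCurve p Ω μ)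
    (hΨ : ContDiff ℝ 1 Ψ) (hc : HasCompactSupport Ψ) {t : ℝ} (ht : t ∈ Ioo (0 : ℝ) 1) :
    HasDerivAt (fun s => ∫ x, (Ψ (s, x) - Ψ (t, x)) ∂μ s)
      (∫ x, fderiv ℝ Ψ (t, x) (1, 0) ∂μ t) t := by
  obtain ⟨B, hB⟩ := hc.exists_bound_of_continuous hΨ.continuous
  obtain ⟨B', hB'⟩ := (hc.fderiv ℝ).exists_bound_of_continuous (hΨ.continuous_fderiv one_ne_zero)
  have hcont : Continuous fun x => fderiv ℝ Ψ (t, x) (1, 0) :=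
    ((hΨ.continuous_fderiv one_ne_zero).comp (Continuous.prodMk_right t)).clm_apply
      continuous_const
  have hbd (x : E) : ‖fderiv ℝ Ψ (t, x) (1, 0)‖ ≤ B' :=
    (ContinuousLinearMap.le_of_opNorm_le _ (hB' (t, x)) _).trans_eq (by simp [Prod.norm_def])
  have hw := ((hμ.continuousOn_integral hp hcont hbd).continuousAt
    (Icc_mem_nhds ht.1 ht.2))
  rw [hasDerivAt_iff_isLittleO, Asymptotics.isLittleO_iff]
  intro c hc0
  obtain ⟨δ, hδ, h⟩ := exists_forall_norm_sub_sub_le hΨ hc (half_pos hc0)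
  filter_upwards [Ioo_mem_nhds ht.1 ht.2, Metric.ball_mem_nhds t hδ,
    hw (Metric.closedBall_mem_nhds _ (half_pos hc0))] with s hs hsδ hsw
  have := (hμ.1 s (Ioo_subset_Icc_self hs)).1
  have hbi (a : ℝ) : Integrable (fun x => Ψ (a, x)) (μ s) :=
    Integrable.of_bound (hΨ.continuous.comp
        (Continuous.prodMk_right a)).aestronglyMeasurable B (ae_of_all _ fun x => hB _)
  have hi : Integrable (fun x => fderiv ℝ Ψ (t, x) (1, 0)) (μ s) :=
    Integrable.of_bound hcont.aestronglyMeasurable B' (ae_of_all _ hbd)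
  rw [mem_preimage, Metric.mem_closedBall, Real.dist_eq] at hsw
  have e : ∫ x, (Ψ (s, x) - Ψ (t, x)) ∂μ s = ∫ x, (Ψ (s, x) - Ψ (t, x)
      - (s - t) * fderiv ℝ Ψ (t, x) (1, 0)) ∂μ s + (s - t) * ∫ x, fderiv ℝ Ψ (t, x) (1, 0) ∂μ s := by
    rw [integral_sub (by exact (hbi s).sub (hbi t)) (hi.const_mul _), integral_const_mul]; ring
  have h1 : ‖∫ x, (Ψ (s, x) - Ψ (t, x) - (s - t) * fderiv ℝ Ψ (t, x) (1, 0)) ∂μ s‖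
      ≤ c / 2 * |s - t| := by
    refine (norm_integral_le_of_norm_le_const (ae_of_all _ fun x => h s t x hsδ)).trans_eq ?_
    simp
  have h2 : |(s - t) * (∫ x, fderiv ℝ Ψ (t, x) (1, 0) ∂μ s - ∫ x, fderiv ℝ Ψ (t, x) (1, 0) ∂μ t)|
      ≤ c / 2 * |s - t| := by
    rw [abs_mul, mul_comm]; gcongr
  simp only [sub_self, integral_zero, sub_zero, smul_eq_mul, Real.norm_eq_abs] at h1 ⊢
  rw [e, add_sub_assoc, ← mul_sub]
  refine (abs_add_le _ _).trans ?_
  linarith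

/-- The continuity equation holds against compactly supported test functions on space-time. -/
theorem IsVelocityField.integral_slice_sub (hp : 1 ≤ p) (hμ : IsLipschitzCurve p Ω μ)
    (hv : IsVelocityField p μ v) (hΨ : ContDiff ℝ 1 Ψ) (hc : HasCompactSupport Ψ) :
    IntegrableOn (fun s => ∫ x, fderiv ℝ Ψ (s, x) (1, v s x) ∂μ s) (Icc (0 : ℝ) 1) ∧
      ∀ t₁ ∈ Icc (0 : ℝ) 1, ∀ t₂ ∈ Icc (0 : ℝ) 1, t₁ < t₂ →
        ∫ x, Ψ (t₂, x) ∂μ t₂ - ∫ x, Ψ (t₁, x) ∂μ t₁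
          = ∫ s in t₁..t₂, ∫ x, fderiv ℝ Ψ (s, x) (1, v s x) ∂μ s := by
  obtain ⟨L, hL⟩ := hμ.exists_lipschitzOnWith_integral hp
  obtain ⟨B, hB⟩ := hc.exists_bound_of_continuous hΨ.continuous
  obtain ⟨K, hK⟩ := hΨ.lipschitzWith_of_hasCompactSupport hc one_ne_zero
  have hbi (r a : ℝ) (hr : r ∈ Icc (0 : ℝ) 1) : Integrable (fun x => Ψ (a, x)) (μ r) := by
    have := (hμ.1 r hr).1
    exact Integrable.of_bound (hΨ.continuous.comp
      (Continuous.prodMk_right a)).aestronglyMeasurable B (ae_of_all _ fun x => hB _)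
  set G : ℝ → ℝ := fun t => ∫ x, Ψ (t, x) ∂μ t with hG
  -- The product rule: the first term varies the test function, the second varies only the measure.
  have hsplit (s t : ℝ) (hs : s ∈ Icc (0 : ℝ) 1) :
      G s = ∫ x, (Ψ (s, x) - Ψ (t, x)) ∂μ s + ∫ x, Ψ (t, x) ∂μ s := by
    rw [integral_sub (hbi s s hs) (hbi s t hs)]; ring
  have hGlip : LipschitzOnWith (K + K * L) G (Icc 0 1) := by
    refine LipschitzOnWith.of_dist_le_mul fun s hs t ht => ?_
    have := (hμ.1 s hs).1
    have h1 : ‖∫ x, (Ψ (s, x) - Ψ (t, x)) ∂μ s‖ ≤ K * |s - t| := by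
      refine (norm_integral_le_of_norm_le_const (C := K * |s - t|)
        (ae_of_all _ fun x => ?_)).trans_eq (by simp)
      simpa [dist_eq_norm, Prod.norm_def] using hK.dist_le_mul (s, x) (t, x)
    have hKt : LipschitzWith K fun x => Ψ (t, x) := by
      simpa [Function.comp_def] using hK.comp (LipschitzWith.prodMk_left t)
    have h2 := (hL K _ hKt ⟨B, fun x => hB _⟩).dist_le_mul s hs t ht
    rw [Real.dist_eq, NNReal.coe_mul] at h2
    rw [Real.dist_eq, hsplit s t hs, add_sub_assoc, Real.dist_eq, NNReal.coe_add, add_mul,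
      NNReal.coe_mul]
    exact (abs_add_le _ _).trans (add_le_add h1 h2)
  have hderiv : ∀ᵐ t ∂volume.restrict (Icc (0 : ℝ) 1),
      deriv G t = ∫ x, fderiv ℝ Ψ (t, x) (1, v t x) ∂μ t := by
    filter_upwards [hv.ae_hasDerivAt_slice hp hμ hΨ hc, ae_restrict_Icc_mem_Ioo, hv.1]
      with t h1 ht hvt
    have hprob := (hμ.1 t (Ioo_subset_Icc_self ht)).1
    have hvi : Integrable (v t) (μ t) := hvt.integrable (ENNReal.one_le_ofReal.2 hp)
    have h2 := ((hμ.hasDerivAt_integral_sub hp hΨ hc ht).add h1).congr_of_eventuallyEq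
      (f₁ := G) (by
        filter_upwards [Ioo_mem_nhds ht.1 ht.2] with s hs
        exact hsplit s t (Ioo_subset_Icc_self hs))
    rw [h2.deriv, ← integral_add]
    · simp [← map_add]
    · simpa using integrable_fderiv_slice_apply hΨ hc t 1 (integrable_zero E E (μ t))
    · exact integrable_fderiv_slice_apply hΨ hc t 0 hvi
  -- Absolute continuity yields both claims: the derivative is integrable and integrates to the
  -- increments of `G`.
  have hac := LipschitzOnWith.absolutelyContinuousOnInterval (a := 0) (b := 1)
    (by rwa [uIcc_of_le zero_le_one])
  constructor
  · refine IntegrableOn.congr_fun_ae ?_ hderiv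
    rw [← intervalIntegrable_iff_integrableOn_Icc_of_le zero_le_one]
    exact hac.intervalIntegrable_deriv
  · intro t₁ h₁ t₂ h₂ hlt
    have hsub : Icc t₁ t₂ ⊆ Icc 0 1 := Icc_subset_Icc h₁.1 h₂.2
    have := (hac.mono (c := t₁) (d := t₂)
      (by rwa [uIcc_of_le hlt.le, uIcc_of_le zero_le_one])).integral_deriv_eq_sub
    rw [← this]
    refine intervalIntegral.integral_congr_ae_restrict ?_
    rw [uIoc_of_le hlt.le]
    exact ae_restrict_of_ae_restrict_of_subset (Ioc_subset_Icc_self.trans hsub) hderiv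

end TimeDependent

/-! ### Uniform properness and the pullback of test functions -/

section Isotopy

open Filter Topology
open scoped Manifold

variable {E : Type*} [NormedAddCommGroup E] {Ω : Set E} {T : ℝ → E → E}

/-- A continuous family of homeomorphisms of a closed convex set is uniformly proper. -/
theorem exists_forall_norm_le_of_norm_apply_le [NormedSpace ℝ E] [ProperSpace E]
    (hΩ : IsClosed Ω) (hconv : Convex ℝ Ω)
    (hT : ContinuousOn (fun z : ℝ × E => T z.1 z.2) (Icc (0 : ℝ) 1 ×ˢ Ω))
    (hinv : ∀ t ∈ Icc (0 : ℝ) 1, ∃ g : E → E, ContinuousOn g Ω ∧ MapsTo g Ω Ω ∧ InvOn g (T t) Ω Ω)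
    (hmaps : ∀ t ∈ Icc (0 : ℝ) 1, MapsTo (T t) Ω Ω) (r : ℝ) :
    ∃ R, ∀ t ∈ Icc (0 : ℝ) 1, ∀ x ∈ Ω, ‖T t x‖ ≤ r → ‖x‖ ≤ R := by
  rcases Ω.eq_empty_or_nonempty with rfl | ⟨x₀, hx₀⟩
  · exact ⟨0, by simp⟩
  obtain ⟨r₀, hr₀⟩ : ∃ r₀, ∀ t ∈ Icc (0 : ℝ) 1, ‖T t x₀‖ ≤ r₀ :=
    isCompact_Icc.exists_bound_of_continuousOn
      (hT.comp (Continuous.prodMk_left x₀).continuousOn fun t ht => ⟨ht, hx₀⟩)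
  -- With this radius, `x₀` belongs to the sublevel set at every time.
  set r' := max r r₀
  -- the sublevel set at a fixed time is the continuous image of a connected compact set
  have hcompact (ρ : ℝ) : IsCompact (Ω ∩ Metric.closedBall 0 ρ) :=
    (isCompact_closedBall 0 ρ).inter_left hΩ
  have hmeet {t : ℝ} (ht : t ∈ Icc (0 : ℝ) 1) {x : E} (hx : x ∈ Ω) (hxr : ‖T t x‖ ≤ r') {R : ℝ}
      (hR : ‖x₀‖ ≤ R) (hRx : R ≤ ‖x‖) : ∃ z ∈ Ω, ‖z‖ = R ∧ ‖T t z‖ ≤ r' := by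
    obtain ⟨g, hg, hgm, hgl, hgr⟩ := hinv t ht
    have hpre : IsPreconnected (Ω ∩ Metric.closedBall 0 r') :=
      (hconv.inter (convex_closedBall _ _)).isPreconnected
    have himg := hpre.image (fun y => ‖g y‖) ((hg.mono inter_subset_left).norm)
    have hmem {y : E} (hy : y ∈ Ω) (hyr : ‖T t y‖ ≤ r') :
        ‖y‖ ∈ (fun y => ‖g y‖) '' (Ω ∩ Metric.closedBall 0 r') :=
      ⟨T t y, ⟨hmaps t ht hy, by simpa⟩, by simp [hgl hy]⟩
    obtain ⟨y, ⟨hyΩ, hyr⟩, hyR⟩ := himg.Icc_subset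
      (hmem hx₀ ((hr₀ t ht).trans (le_max_right _ _))) (hmem hx hxr) ⟨hR, hRx⟩
    exact ⟨g y, hgm hyΩ, hyR, by simpa [hgr hyΩ] using hyr⟩
  -- The times at which the sublevel set meets the sphere of radius `‖x₀‖ + n`. Connectedness makes
  -- these sets decreasing, and joint continuity of `T` makes them compact.
  let A : ℕ → Set ℝ := fun n => Prod.fst ''
    ((Icc (0 : ℝ) 1 ×ˢ (Ω ∩ Metric.sphere 0 (‖x₀‖ + n))) ∩
      (fun z : ℝ × E => T z.1 z.2) ⁻¹' Metric.closedBall 0 r')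
  have hA {n : ℕ} {t : ℝ} : t ∈ A n ↔
      t ∈ Icc (0 : ℝ) 1 ∧ ∃ z ∈ Ω, ‖z‖ = ‖x₀‖ + n ∧ ‖T t z‖ ≤ r' := by
    simp only [A, mem_image, mem_inter_iff, mem_prod, mem_sphere_zero_iff_norm, mem_preimage,
      mem_closedBall_zero_iff, Prod.exists, exists_and_right, exists_eq_right]
    tauto
  have hAcomp (n : ℕ) : IsCompact (A n) := by
    refine IsCompact.image ?_ continuous_fst
    have h1 : IsCompact (Icc (0 : ℝ) 1 ×ˢ (Ω ∩ Metric.sphere 0 (‖x₀‖ + n))) :=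
      isCompact_Icc.prod ((isCompact_sphere _ _).inter_left hΩ)
    exact h1.of_isClosed_subset
      ((hT.mono (prod_mono_right inter_subset_left)).preimage_isClosed_of_isClosed h1.isClosed
        Metric.isClosed_closedBall) inter_subset_left
  have hAanti (n : ℕ) : A (n + 1) ⊆ A n := by
    intro t ht
    obtain ⟨htI, z, hz, hzn, hzr⟩ := hA.1 ht
    exact hA.2 ⟨htI, hmeet htI hz hzr (by simp) (by rw [hzn]; push_cast; linarith)⟩
  -- If none is empty, Cantor's intersection theorem gives one time at which the sublevel set is
  -- unbounded, although it is the image of a compact set under the continuous inverse. Otherwise an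
  -- empty `A n` gives a bound.
  by_cases hne : ∀ n, (A n).Nonempty
  · exfalso
    obtain ⟨t, ht⟩ := IsCompact.nonempty_iInter_of_sequence_nonempty_isCompact_isClosed A hAanti hne
      (hAcomp 0) fun n => (hAcomp n).isClosed
    rw [mem_iInter] at ht
    have htI := (hA.1 (ht 0)).1
    obtain ⟨g, hg, hgm, hgl, hgr⟩ := hinv t htI
    obtain ⟨R, hR⟩ := (hcompact r').exists_bound_of_continuousOn (hg.mono inter_subset_left)
    obtain ⟨n, hn⟩ := exists_nat_gt R
    obtain ⟨-, z, hz, hzn, hzr⟩ := hA.1 (ht n)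
    have := hR (T t z) ⟨hmaps t htI hz, by simpa⟩
    rw [hgl hz, hzn] at this
    linarith [norm_nonneg x₀]
  · push Not at hne
    obtain ⟨n, hn⟩ := hne
    refine ⟨‖x₀‖ + n, fun t ht x hx hxr => ?_⟩
    by_contra! hlt
    have : t ∈ A n :=
      hA.2 ⟨ht, hmeet ht hx (hxr.trans (le_max_left _ _)) (by simp) hlt.le⟩
    simp [hn] at this

variable [NormedSpace ℝ E]

/-- A test function composed with a smooth isotopy is, near `[0, 1] × Ω`, a compactly supported
function on space-time. -/
theorem exists_testFunction_comp [FiniteDimensional ℝ E] (hΩ : IsClosed Ω) (hconv : Convex ℝ Ω)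
    (hT : IsSmoothOn (fun z : ℝ × E => T z.1 z.2) (Icc (0 : ℝ) 1 ×ˢ Ω))
    (hdiff : ∀ t ∈ Icc (0 : ℝ) 1, IsDiffeoOn (T t) Ω) {φ : E → ℝ} (hφ : ContDiff ℝ 1 φ)
    (hc : HasCompactSupport φ) :
    ∃ Ψ : ℝ × E → ℝ, ContDiff ℝ 1 Ψ ∧ HasCompactSupport Ψ ∧
      ∀ t ∈ Icc (0 : ℝ) 1, ∀ x ∈ Ω, Ψ =ᶠ[𝓝 (t, x)] fun z => φ (T z.1 z.2) := by
  obtain ⟨U, hU, hsub, hTU⟩ := hT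
  have hcont : ContinuousOn (fun z : ℝ × E => T z.1 z.2) U := hTU.continuousOn
  obtain ⟨r, hr⟩ := hc.isBounded.exists_norm_le
  obtain ⟨R, hR⟩ := exists_forall_norm_le_of_norm_apply_le hΩ hconv (hcont.mono hsub)
    (fun t ht => by
      obtain ⟨-, -, g, ⟨V, -, hV, hgV⟩, hgm, hgi⟩ := hdiff t ht
      exact ⟨g, hgV.continuousOn.mono hV, hgm, hgi⟩) (fun t ht => (hdiff t ht).2.1) r
  set K : Set (ℝ × E) := (Icc (0 : ℝ) 1 ×ˢ (Ω ∩ Metric.closedBall 0 R)) ∩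
    (fun z : ℝ × E => T z.1 z.2) ⁻¹' tsupport φ with hK
  have hK₀ : IsCompact (Icc (0 : ℝ) 1 ×ˢ (Ω ∩ Metric.closedBall 0 R)) :=
    isCompact_Icc.prod ((isCompact_closedBall _ _).inter_left hΩ)
  have hKc : IsCompact K := hK₀.of_isClosed_subset
    (((hcont.mono hsub).mono (prod_mono_right inter_subset_left)).preimage_isClosed_of_isClosed
      hK₀.isClosed (isClosed_tsupport φ)) inter_subset_left
  have hKU : K ⊆ U :=
    inter_subset_left.trans ((prod_mono_right inter_subset_left).trans hsub)
  obtain ⟨K', hK'c, hKK', hK'U⟩ := exists_compact_between hKc hU hKU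
  -- `K` is the part of `[0, 1] × Ω` that `T` sends into the support of `φ`. The cut-off is `1` near
  -- `K` and vanishes off `K'`, hence wherever `T` is not known to be smooth.
  obtain ⟨χ, hχ1, hχ0, -⟩ := exists_contMDiffMap_one_nhds_of_subset_interior
    (n := 1) 𝓘(ℝ, ℝ × E) hKc.isClosed hKK'
  have hχ : ContDiff ℝ 1 χ := contMDiff_iff_contDiff.1 χ.contMDiff
  refine ⟨fun z => χ z * φ (T z.1 z.2), ?_, ?_, ?_⟩
  · rw [contDiff_iff_contDiffAt]
    intro z
    by_cases hz : z ∈ U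
    · exact hχ.contDiffAt.mul
        (hφ.contDiffAt.comp z (((hTU.of_le (by simp)).contDiffAt (hU.mem_nhds hz))))
    · refine contDiffAt_const (c := (0 : ℝ)) |>.congr_of_eventuallyEq ?_
      filter_upwards [hK'c.isClosed.isOpen_compl.mem_nhds fun h => hz (hK'U h)] with y hy
      simp [hχ0 y hy]
  · exact HasCompactSupport.intro hK'c fun z hz => by simp [hχ0 z hz]
  · intro t ht x hx
    -- Either the point lies in `K`, near which `χ = 1`, or `φ ∘ T` vanishes nearby and the cut-off
    -- is harmless.
    by_cases hz : T t x ∈ tsupport φ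
    · have hzK : (t, x) ∈ K := ⟨⟨ht, hx, by simpa using hR t ht x hx (hr _ hz)⟩, hz⟩
      filter_upwards [(eventually_nhdsSet_iff_forall.1 hχ1) _ hzK] with z hz
      simp [hz]
    · have h1 : ∀ᶠ z : ℝ × E in 𝓝 (t, x), T z.1 z.2 ∈ (tsupport φ)ᶜ :=
        (hcont.continuousAt (hU.mem_nhds (hsub ⟨ht, hx⟩))).eventually
          ((isClosed_tsupport φ).isOpen_compl.mem_nhds hz)
      filter_upwards [h1] with z hz
      simp [image_eq_zero_of_notMem_tsupport hz]

theorem IsSmoothOn.differentiableAt {F G : Type*} [NormedAddCommGroup F] [NormedSpace ℝ F]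
    [NormedAddCommGroup G] [NormedSpace ℝ G] {f : F → G} {s : Set F} (hf : IsSmoothOn f s) {x : F}
    (hx : x ∈ s) : DifferentiableAt ℝ f x := by
  obtain ⟨U, hU, hsub, hfU⟩ := hf
  exact (hfU.differentiableOn (by simp)).differentiableAt (hU.mem_nhds (hsub hx))

theorem IsSmoothOn.continuousOn {F G : Type*} [NormedAddCommGroup F] [NormedSpace ℝ F]
    [NormedAddCommGroup G] [NormedSpace ℝ G] {f : F → G} {s : Set F} (hf : IsSmoothOn f s) :
    ContinuousOn f s := fun _ hx => (hf.differentiableAt hx).continuousAt.continuousWithinAt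

theorem IsSmoothOn.continuousOn_fderiv {F G : Type*} [NormedAddCommGroup F] [NormedSpace ℝ F]
    [NormedAddCommGroup G] [NormedSpace ℝ G] {f : F → G} {s : Set F} (hf : IsSmoothOn f s) :
    ContinuousOn (fderiv ℝ f) s := by
  obtain ⟨U, hU, hsub, hfU⟩ := hf
  exact (hfU.continuousOn_fderiv_of_isOpen hU (by simp)).mono hsub

theorem hasFDerivAt_slice_right {t : ℝ} {x : E}
    (h : DifferentiableAt ℝ (fun z : ℝ × E => T z.1 z.2) (t, x)) :
    HasFDerivAt (T t) ((fderiv ℝ (fun z : ℝ × E => T z.1 z.2) (t, x)).comp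
      (ContinuousLinearMap.inr ℝ ℝ E)) x :=
  HasFDerivAt.comp (g := fun z : ℝ × E => T z.1 z.2) x h.hasFDerivAt (hasFDerivAt_prodMk_right t x)

theorem hasDerivAt_slice_left {t : ℝ} {x : E}
    (h : DifferentiableAt ℝ (fun z : ℝ × E => T z.1 z.2) (t, x)) :
    HasDerivAt (fun s => T s x) (fderiv ℝ (fun z : ℝ × E => T z.1 z.2) (t, x) (1, 0)) t := by
  have := HasFDerivAt.comp (g := fun z : ℝ × E => T z.1 z.2) (f := fun s => (s, x)) t
    h.hasFDerivAt (hasFDerivAt_prodMk_left (𝕜 := ℝ) t x)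
  simpa [Function.comp_def] using this.hasDerivAt

/-- Reading the field as one directional derivative of the joint map gives access to its
measurability and to the chain rule. -/
theorem transportedVelocity_eq {t : ℝ} {x : E} (v : ℝ → E → E)
    (h : DifferentiableAt ℝ (fun z : ℝ × E => T z.1 z.2) (t, x)) :
    transportedVelocity T v t x = fderiv ℝ (fun z : ℝ × E => T z.1 z.2) (t, x) (1, v t x) := by
  rw [transportedVelocity, (hasFDerivAt_slice_right h).fderiv, (hasDerivAt_slice_left h).deriv]
  simp [← map_add]

theorem fderiv_testFunction_comp {Ψ : ℝ × E → ℝ} {φ : E → ℝ} (hφ : Differentiable ℝ φ) {t : ℝ}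
    {x : E} (v : ℝ → E → E) (h : DifferentiableAt ℝ (fun z : ℝ × E => T z.1 z.2) (t, x))
    (hΨ : Ψ =ᶠ[𝓝 (t, x)] fun z => φ (T z.1 z.2)) :
    fderiv ℝ Ψ (t, x) (1, v t x) = fderiv ℝ φ (T t x) (transportedVelocity T v t x) := by
  have := HasFDerivAt.comp (g := φ) (t, x) (hφ (T t x)).hasFDerivAt h.hasFDerivAt
  rw [hΨ.fderiv_eq, transportedVelocity_eq v h]
  exact congrArg (fun L => L (1, v t x)) this.fderiv

end Isotopy

/-! ### Images of measures, of fields and of the curve -/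

section Pushforward

open Filter Topology

theorem ContinuousOn.aestronglyMeasurable_of_measure_compl_eq_zero {E F : Type*}
    [TopologicalSpace E] [MeasurableSpace E] [OpensMeasurableSpace E]
    [SecondCountableTopology E] [TopologicalSpace F] [TopologicalSpace.PseudoMetrizableSpace F]
    {Ω : Set E} {μ : Measure E} {f : E → F} (hf : ContinuousOn f Ω)
    (hΩ : MeasurableSet Ω) (hμ : μ Ωᶜ = 0) : AEStronglyMeasurable f μ := by
  have := hf.aestronglyMeasurable (μ := μ) hΩ
  rwa [Measure.restrict_eq_self_of_ae_mem (show ∀ᵐ x ∂μ, x ∈ Ω from hμ)] at this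

section Inverse

variable {X Y F : Type*} [MeasurableSpace X] [MeasurableSpace Y] [NormedAddCommGroup F]
  {μ : Measure X} {f : X → Y} {g : Y → X} {w : X → F}

/-- Through this identity, properties of `w ∘ g` under `μ.map f` reduce to those of `w` under `μ`.
-/
theorem map_map_eq_self_of_ae_leftInverse (hf : AEMeasurable f μ) (hg : AEMeasurable g (μ.map f))
    (hgf : ∀ᵐ x ∂μ, g (f x) = x) : (μ.map f).map g = μ := by
  rw [AEMeasurable.map_map_of_aemeasurable hg hf]
  exact (Measure.map_congr (g := id) hgf).trans Measure.map_id

theorem MeasureTheory.AEStronglyMeasurable.comp_of_ae_leftInverse (hw : AEStronglyMeasurable w μ)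
    (hf : AEMeasurable f μ) (hg : AEMeasurable g (μ.map f)) (hgf : ∀ᵐ x ∂μ, g (f x) = x) :
    AEStronglyMeasurable (w ∘ g) (μ.map f) :=
  AEStronglyMeasurable.comp_aemeasurable
    (by rwa [map_map_eq_self_of_ae_leftInverse hf hg hgf]) hg

theorem MeasureTheory.MemLp.comp_of_ae_leftInverse {p : ℝ≥0∞} (hw : MemLp w p μ)
    (hf : AEMeasurable f μ) (hg : AEMeasurable g (μ.map f)) (hgf : ∀ᵐ x ∂μ, g (f x) = x) :
    MemLp (w ∘ g) p (μ.map f) :=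
  MemLp.comp_of_map (by rwa [map_map_eq_self_of_ae_leftInverse hf hg hgf]) hg

theorem setIntegral_map_comp_of_ae_leftInverse [NormedSpace ℝ F] (hw : AEStronglyMeasurable w μ)
    (hf : AEMeasurable f μ) (hg : AEMeasurable g (μ.map f)) (hgf : ∀ᵐ x ∂μ, g (f x) = x)
    {A : Set Y} (hA : MeasurableSet A) :
    ∫ y in A, w (g y) ∂μ.map f = ∫ x in f ⁻¹' A, w x ∂μ := by
  rw [setIntegral_map (f := fun y => w (g y)) hA (hw.comp_of_ae_leftInverse hf hg hgf) hf]
  refine integral_congr_ae (ae_restrict_of_ae ?_)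
  filter_upwards [hgf] with x hx
  rw [hx]

end Inverse

variable {E : Type*} [NormedAddCommGroup E] [MeasurableSpace E] [BorelSpace E]
  [SecondCountableTopology E] {Ω : Set E}

theorem memLp_id_iff {μ : Measure E} {p : ℝ} (hp : 0 < p) :
    MemLp (fun x : E => x) (ENNReal.ofReal p) μ ↔ ∫⁻ x, ‖x‖ₑ ^ p ∂μ < ⊤ := by
  have h := eLpNorm_lt_top_iff_lintegral_rpow_enorm_lt_top (f := fun x : E => x) (μ := μ)
    (ENNReal.ofReal_pos.2 hp).ne' ENNReal.ofReal_ne_top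
  rw [ENNReal.toReal_ofReal hp.le] at h
  exact ⟨fun h' => h.1 h'.2, fun h' => ⟨aestronglyMeasurable_id, h.2 h'⟩⟩

theorem map_mem_wassersteinSpace {p : ℝ} (hp : 0 < p) (hΩ : MeasurableSet Ω) {μ : Measure E}
    (hμ : μ ∈ wassersteinSpace p Ω) {f : E → E} (hf : AEMeasurable f μ) (hmaps : MapsTo f Ω Ω)
    {C : ℝ≥0} (hC : LipschitzOnWith C f Ω) : μ.map f ∈ wassersteinSpace p Ω := by
  obtain ⟨hprob, hsupp, hmom⟩ := hμ
  have hae : ∀ᵐ x ∂μ, x ∈ Ω := hsupp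
  obtain ⟨x₀, hx₀⟩ := hae.exists
  refine ⟨Measure.isProbabilityMeasure_map hf, ?_, ?_⟩
  · rw [Measure.map_apply_of_aemeasurable hf hΩ.compl]
    exact measure_mono_null (fun x hx hxΩ => hx (hmaps hxΩ)) hsupp
  · rw [← memLp_id_iff hp] at hmom ⊢
    refine (memLp_map_measure_iff aestronglyMeasurable_id hf).2 ?_
    have h1 : MemLp (fun x => ‖f x₀‖ + C * (‖x‖ + ‖x₀‖)) (ENNReal.ofReal p) μ :=
      (memLp_const ‖f x₀‖).add ((hmom.norm.add (memLp_const ‖x₀‖)).const_mul (C : ℝ))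
    refine h1.mono' hf.aestronglyMeasurable ?_
    filter_upwards [hae] with x hx
    have h2 := hC.dist_le_mul x hx x₀ hx₀
    rw [dist_eq_norm, dist_eq_norm] at h2
    calc ‖f x‖ ≤ ‖f x₀‖ + ‖f x - f x₀‖ := norm_le_norm_add_norm_sub' _ _
      _ ≤ _ := by gcongr; exact h2.trans (by gcongr; exact norm_sub_le _ _)

variable [NormedSpace ℝ E]

theorem IsDiffeoOn.exists_ae_leftInverse {f : E → E} (hf : IsDiffeoOn f Ω) (hΩ : MeasurableSet Ω)
    {μ : Measure E} (hμ : μ Ωᶜ = 0) :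
    AEMeasurable f μ ∧ ∃ g : E → E, AEMeasurable g (μ.map f) ∧ ∀ᵐ x ∂μ, g (f x) = x := by
  obtain ⟨hfs, hmaps, g, hgs, -, hgi⟩ := hf
  have hfm : AEMeasurable f μ :=
    (hfs.continuousOn.aestronglyMeasurable_of_measure_compl_eq_zero hΩ hμ).aemeasurable
  refine ⟨hfm, g, ?_, ?_⟩
  · refine (hgs.continuousOn.aestronglyMeasurable_of_measure_compl_eq_zero hΩ ?_).aemeasurable
    rw [Measure.map_apply_of_aemeasurable hfm hΩ.compl]
    exact measure_mono_null (fun x hx hxΩ => hx (hmaps hxΩ)) hμ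
  · filter_upwards [show ∀ᵐ x ∂μ, x ∈ Ω from hμ] with x hx using hgi.1 hx

variable {T : ℝ → E → E}

/-- The norm is at most `C ‖v‖ + C (1 + ‖x‖)`: linear growth of `∂T/∂t` is matched by the finite
`p`-th moment. -/
theorem memLp_transportedVelocity {p : ℝ≥0∞} (hΩ : MeasurableSet Ω)
    (hT : IsSmoothOn (fun z : ℝ × E => T z.1 z.2) (Icc (0 : ℝ) 1 ×ˢ Ω)) {C : ℝ} {t : ℝ}
    (ht : t ∈ Icc (0 : ℝ) 1)
    (hC : ∀ x ∈ Ω, ‖fderiv ℝ (T t) x‖ ≤ C ∧ ‖deriv (fun s => T s x) t‖ ≤ C * (1 + ‖x‖))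
    {μ : Measure E} [IsFiniteMeasure μ] (hμ : μ Ωᶜ = 0) (hid : MemLp (fun x : E => x) p μ)
    {v : ℝ → E → E} (hv : MemLp (v t) p μ) : MemLp (transportedVelocity T v t) p μ := by
  have hae : ∀ᵐ x ∂μ, x ∈ Ω := hμ
  have h1 : MemLp (fun x => C * ‖v t x‖ + C * (1 + ‖x‖)) p μ :=
    (hv.norm.const_mul C).add (((memLp_const (1 : ℝ)).add hid.norm).const_mul C)
  refine h1.mono' ?_ ?_
  · have hD : AEStronglyMeasurable
        (fun x => fderiv ℝ (fun z : ℝ × E => T z.1 z.2) (t, x)) μ :=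
      (hT.continuousOn_fderiv.comp (Continuous.prodMk_right t).continuousOn
        fun x hx => ⟨ht, hx⟩).aestronglyMeasurable_of_measure_compl_eq_zero hΩ hμ
    have hv1 : AEStronglyMeasurable (fun x => ((1 : ℝ), v t x)) μ :=
      aestronglyMeasurable_const.prodMk hv.1
    have hcont : Continuous fun q : (ℝ × E →L[ℝ] E) × (ℝ × E) => q.1 q.2 :=
      isBoundedBilinearMap_apply.continuous
    refine (hcont.comp_aestronglyMeasurable (hD.prodMk hv1)).congr ?_
    filter_upwards [hae] with x hx
    exact (transportedVelocity_eq v (hT.differentiableAt ⟨ht, hx⟩)).symm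
  · filter_upwards [hae] with x hx
    have h2 := (fderiv ℝ (T t) x).le_of_opNorm_le (hC x hx).1 (v t x)
    exact (norm_add_le _ _).trans (add_le_add h2 (hC x hx).2)

theorem IsLipschitzCurve.map {p : ℝ} (hp : 1 ≤ p) (hΩ : IsClosed Ω) (hconv : Convex ℝ Ω)
    {μ : ℝ → Measure E} (hμ : IsLipschitzCurve p Ω μ)
    (hT : IsSmoothOn (fun z : ℝ × E => T z.1 z.2) (Icc (0 : ℝ) 1 ×ˢ Ω))
    (hdiff : ∀ t ∈ Icc (0 : ℝ) 1, IsDiffeoOn (T t) Ω) {C : ℝ≥0}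
    (hC : ∀ t ∈ Icc (0 : ℝ) 1, ∀ x ∈ Ω,
      ‖fderiv ℝ (T t) x‖ ≤ C ∧ ‖deriv (fun s => T s x) t‖ ≤ C * (1 + ‖x‖)) :
    IsLipschitzCurve p Ω fun t => (μ t).map (T t) := by
  have hp0 : 0 < p := by linarith
  obtain ⟨hmem, L, hL⟩ := hμ
  have hTlip {t : ℝ} (ht : t ∈ Icc (0 : ℝ) 1) : LipschitzOnWith C (T t) Ω :=
    hconv.lipschitzOnWith_of_nnnorm_fderiv_le
      (fun x hx => (hdiff t ht).1.differentiableAt hx) fun x hx => (hC t ht x hx).1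
  have hTm {t : ℝ} (ht : t ∈ Icc (0 : ℝ) 1) : AEMeasurable (T t) (μ t) :=
    ((hdiff t ht).exists_ae_leftInverse hΩ.measurableSet (hmem t ht).2.1).1
  refine ⟨fun t ht => map_mem_wassersteinSpace hp0 hΩ.measurableSet (hmem t ht) (hTm ht)
    (hdiff t ht).2.1 (hTlip ht), ?_⟩
  have h0 : (0 : ℝ) ∈ Icc (0 : ℝ) 1 := by simp
  have hW {s t : ℝ} (hs : s ∈ Icc (0 : ℝ) 1) (ht : t ∈ Icc (0 : ℝ) 1) :
      wassersteinDist p (μ s) (μ t) ≠ ⊤ :=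
    ne_top_of_le_ne_top (ENNReal.mul_ne_top (by simp) (edist_ne_top _ _)) (hL s hs t ht)
  obtain ⟨m, hm⟩ : ∃ m : ℝ≥0, (m : ℝ≥0∞) = (∫⁻ x, ‖x‖ₑ ^ p ∂μ 0) ^ (1 / p) :=
    ⟨_, ENNReal.coe_toNNReal (ENNReal.rpow_ne_top_of_nonneg (by positivity) (hmem 0 h0).2.2.ne)⟩
  have hmom {t : ℝ} (ht : t ∈ Icc (0 : ℝ) 1) : (∫⁻ x, ‖x‖ₑ ^ p ∂μ t) ^ (1 / p) ≤ m + L := by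
    refine (rpow_lintegral_enorm_le_add_wassersteinDist hp (hW h0 ht)).trans ?_
    rw [hm]
    gcongr
    refine (hL 0 h0 t ht).trans (mul_le_of_le_one_right (by simp) ?_)
    rw [edist_dist, Real.dist_eq, zero_sub, abs_neg, abs_of_nonneg ht.1]
    simpa using ht.2
  -- The first summand comes from the motion of the maps, weighted by the moment bound `m + L`; the
  -- second from the motion of the measures.
  refine ⟨C * (1 + (m + L)) + C * L, fun s hs t ht => ?_⟩
  have := (hmem t ht).1
  refine (wassersteinDist_map_le (δ := C * nndist s t) hp (hmem s hs).2.1 (hmem t ht).2.1 (hW hs ht)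
    (hTm hs) (hTm ht) (hTlip hs) fun y hy => ?_).trans ?_
  · have hlip : LipschitzOnWith (C * (1 + ‖y‖₊)) (fun r => T r y) (Icc 0 1) :=
      (convex_Icc 0 1).lipschitzOnWith_of_nnnorm_deriv_le
        (fun r hr => (hasDerivAt_slice_left (hT.differentiableAt ⟨hr, hy⟩)).differentiableAt)
        fun r hr => (hC r hr y hy).2
    refine (hlip hs ht).trans_eq ?_
    rw [edist_nndist]
    push_cast
    rw [enorm_eq_nnnorm]
    ring
  · calc _ ≤ ((C * nndist s t : ℝ≥0) : ℝ≥0∞) * (1 + (m + L)) + C * (L * edist s t) := by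
          gcongr
          · exact hmom ht
          · exact hL s hs t ht
      _ = _ := by
          rw [edist_nndist]
          push_cast
          ring

end Pushforward

/-! ### The pushforward field and its continuity equation -/

section Main

open Filter Topology

variable {E : Type*} [NormedAddCommGroup E] [NormedSpace ℝ E] [FiniteDimensional ℝ E]
  [MeasurableSpace E] [BorelSpace E] {Ω : Set E} {μ : ℝ → Measure E} {T : ℝ → E → E}
  {v v' : ℝ → E → E} {p : ℝ}

theorem setIntegral_inter_preimage_eq {X Y F : Type*} [MeasurableSpace X] [NormedAddCommGroup F]
    [NormedSpace ℝ F] {μ : Measure X} {Ω : Set X} (hμ : μ Ωᶜ = 0) (f : X → Y) (w : X → F)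
    (A : Set Y) : ∫ x in Ω ∩ f ⁻¹' A, w x ∂μ = ∫ x in f ⁻¹' A, w x ∂μ := by
  refine setIntegral_congr_set ?_
  filter_upwards [show ∀ᵐ x ∂μ, x ∈ Ω from hμ] with x hx
  exact propext ⟨fun h => h.2, fun h => ⟨hx, h⟩⟩

/-- Compose with the inverse of `T t`. The inverses may be chosen separately at each time, as the
condition is imposed time by time. -/
theorem exists_isPushforwardField (hΩ : MeasurableSet Ω)
    (hsupp : ∀ t ∈ Icc (0 : ℝ) 1, μ t Ωᶜ = 0)
    (hdiff : ∀ t ∈ Icc (0 : ℝ) 1, IsDiffeoOn (T t) Ω)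
    (hw : ∀ᵐ t ∂volume.restrict (Icc (0 : ℝ) 1), Integrable (transportedVelocity T v t) (μ t)) :
    ∃ v' : ℝ → E → E, IsPushforwardField Ω μ T v v' := by
  have hinv (t : ℝ) (ht : t ∈ Icc (0 : ℝ) 1) :=
    ((hdiff t ht).exists_ae_leftInverse hΩ (hsupp t ht)).2
  choose! g hg hgf using hinv
  refine ⟨fun t y => transportedVelocity T v t (g t y), ?_⟩
  filter_upwards [hw, ae_restrict_mem measurableSet_Icc] with t hwt ht
  have hTm := ((hdiff t ht).exists_ae_leftInverse hΩ (hsupp t ht)).1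
  refine ⟨hwt, ?_, fun A hA => ?_⟩
  · rw [← memLp_one_iff_integrable] at hwt ⊢
    exact hwt.comp_of_ae_leftInverse hTm (hg t ht) (hgf t ht)
  · rw [setIntegral_map_comp_of_ae_leftInverse hwt.1 hTm (hg t ht) (hgf t ht) hA,
      setIntegral_inter_preimage_eq (hsupp t ht)]

/-- A field whose vector measure is the image of that of `∇T_t · v_t + ∂T/∂t` is, almost everywhere,
the latter field composed with the inverse of `T_t`. -/
theorem IsPushforwardField.ae_ae_eq (hΩ : MeasurableSet Ω)
    (hsupp : ∀ t ∈ Icc (0 : ℝ) 1, μ t Ωᶜ = 0)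
    (hdiff : ∀ t ∈ Icc (0 : ℝ) 1, IsDiffeoOn (T t) Ω) (hv' : IsPushforwardField Ω μ T v v') :
    ∀ᵐ t ∂volume.restrict (Icc (0 : ℝ) 1),
      ∃ g : E → E, AEMeasurable g ((μ t).map (T t)) ∧ (∀ᵐ x ∂μ t, g (T t x) = x) ∧
        v' t =ᵐ[(μ t).map (T t)] transportedVelocity T v t ∘ g := by
  filter_upwards [hv', ae_restrict_mem measurableSet_Icc] with t ⟨hwt, hvt, heq⟩ ht
  obtain ⟨hTm, g, hg, hgf⟩ := (hdiff t ht).exists_ae_leftInverse hΩ (hsupp t ht)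
  refine ⟨g, hg, hgf, ?_⟩
  refine Integrable.ae_eq_of_forall_setIntegral_eq _ _ hvt ?_ fun A hA _ => ?_
  · rw [← memLp_one_iff_integrable] at hwt ⊢
    exact hwt.comp_of_ae_leftInverse hTm hg hgf
  · rw [heq A hA, setIntegral_inter_preimage_eq (hsupp t ht)]
    exact (setIntegral_map_comp_of_ae_leftInverse hwt.1 hTm hg hgf hA).symm

/-- The equation for `v'` tested against `φ` is, after the change of variables `y = T t x`, the
equation for `v` tested against the pullback of `φ`. -/
theorem IsPushforwardField.isVelocityField (hp : 1 ≤ p) (hΩ : IsClosed Ω) (hconv : Convex ℝ Ω)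
    (hμ : IsLipschitzCurve p Ω μ)
    (hT : IsSmoothOn (fun z : ℝ × E => T z.1 z.2) (Icc (0 : ℝ) 1 ×ˢ Ω))
    (hdiff : ∀ t ∈ Icc (0 : ℝ) 1, IsDiffeoOn (T t) Ω)
    (hw : ∀ᵐ t ∂volume.restrict (Icc (0 : ℝ) 1),
      MemLp (transportedVelocity T v t) (ENNReal.ofReal p) (μ t))
    (hv : IsVelocityField p μ v) (hv' : IsPushforwardField Ω μ T v v') :
    IsVelocityField p (fun t => (μ t).map (T t)) v' := by
  have hsupp (t : ℝ) (ht : t ∈ Icc (0 : ℝ) 1) : μ t Ωᶜ = 0 := (hμ.1 t ht).2.1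
  have hTm (t : ℝ) (ht : t ∈ Icc (0 : ℝ) 1) : AEMeasurable (T t) (μ t) :=
    ((hdiff t ht).exists_ae_leftInverse hΩ.measurableSet (hsupp t ht)).1
  have hg := hv'.ae_ae_eq hΩ.measurableSet hsupp hdiff
  refine ⟨?_, fun φ hφ hc => ?_⟩
  · filter_upwards [hw, hg, ae_restrict_mem measurableSet_Icc] with t hwt ⟨g, hgm, hgf, heq⟩ ht
    exact (hwt.comp_of_ae_leftInverse (hTm t ht) hgm hgf).ae_eq heq.symm
  · obtain ⟨Ψ, hΨ, hΨc, hΨeq⟩ := exists_testFunction_comp hΩ hconv hT hdiff hφ hc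
    obtain ⟨hint, heq⟩ := hv.integral_slice_sub hp hμ hΨ hΨc
    have hlhs (t : ℝ) (ht : t ∈ Icc (0 : ℝ) 1) :
        ∫ x, φ x ∂(μ t).map (T t) = ∫ x, Ψ (t, x) ∂μ t := by
      rw [integral_map (hTm t ht) hφ.continuous.aestronglyMeasurable]
      refine integral_congr_ae ?_
      filter_upwards [show ∀ᵐ x ∂μ t, x ∈ Ω from hsupp t ht] with x hx
      exact (hΨeq t ht x hx).self_of_nhds.symm
    have hrhs : ∀ᵐ s ∂volume.restrict (Icc (0 : ℝ) 1),
        ∫ x, fderiv ℝ Ψ (s, x) (1, v s x) ∂μ s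
          = ∫ y, fderiv ℝ φ y (v' s y) ∂(μ s).map (T s) := by
      filter_upwards [hv', hg, ae_restrict_mem measurableSet_Icc]
        with s ⟨_, hvs, _⟩ ⟨g, hgm, hgf, hae⟩ hs
      have hcont : Continuous fun q : (E →L[ℝ] ℝ) × E => q.1 q.2 :=
        isBoundedBilinearMap_apply.continuous
      have hmeas : AEStronglyMeasurable (fun y => fderiv ℝ φ y (v' s y)) ((μ s).map (T s)) :=
        hcont.comp_aestronglyMeasurable
          ((hφ.continuous_fderiv one_ne_zero).aestronglyMeasurable.prodMk hvs.1)
      rw [integral_map (hTm s hs) hmeas]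
      refine integral_congr_ae ?_
      filter_upwards [show ∀ᵐ x ∂μ s, x ∈ Ω from hsupp s hs, hgf, ae_of_ae_map (hTm s hs) hae]
        with x hx hgx hvx
      rw [fderiv_testFunction_comp (hφ.differentiable one_ne_zero) v
        (hT.differentiableAt ⟨hs, hx⟩) (hΨeq s hs x hx), hvx, Function.comp_apply, hgx]
    refine ⟨hint.congr_fun_ae hrhs, fun t₁ h₁ t₂ h₂ hlt => ?_⟩
    rw [hlhs t₁ h₁, hlhs t₂ h₂, heq t₁ h₁ t₂ h₂ hlt]
    refine intervalIntegral.integral_congr_ae_restrict ?_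
    rw [uIoc_of_le hlt.le]
    exact ae_restrict_of_ae_restrict_of_subset
      (Ioc_subset_Icc_self.trans (Icc_subset_Icc h₁.1 h₂.2)) hrhs

end Main

theorem mainTheorem4 (d : ℕ) (Ω : Set (EuclideanSpace ℝ (Fin d))) (hΩ_closed : IsClosed Ω)
    (hΩ_convex : Convex ℝ Ω) (p : ℝ) (hp : 1 < p)
    (μ : ℝ → Measure (EuclideanSpace ℝ (Fin d))) (hμ : IsLipschitzCurve p Ω μ)
    (T : ℝ → EuclideanSpace ℝ (Fin d) → EuclideanSpace ℝ (Fin d))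
    (hT_smooth : IsSmoothOn (fun z : ℝ × EuclideanSpace ℝ (Fin d) => T z.1 z.2)
      (Icc (0 : ℝ) 1 ×ˢ Ω))
    (hT_diffeo : ∀ t ∈ Icc (0 : ℝ) 1, IsDiffeoOn (T t) Ω)
    (hT_bound : ∃ C : ℝ, ∀ t ∈ Icc (0 : ℝ) 1, ∀ x ∈ Ω,
      ‖fderiv ℝ (T t) x‖ ≤ C ∧ ‖deriv (fun s => T s x) t‖ ≤ C * (1 + ‖x‖))
    (v : ℝ → EuclideanSpace ℝ (Fin d) → EuclideanSpace ℝ (Fin d))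
    (hv : IsVelocityField p μ v) :
    IsLipschitzCurve p Ω (fun t => (μ t).map (T t)) ∧
      (∃ v' : ℝ → EuclideanSpace ℝ (Fin d) → EuclideanSpace ℝ (Fin d),
        IsPushforwardField Ω μ T v v') ∧
      ∀ v' : ℝ → EuclideanSpace ℝ (Fin d) → EuclideanSpace ℝ (Fin d),
        IsPushforwardField Ω μ T v v' →
          IsVelocityField p (fun t => (μ t).map (T t)) v' := by
  have hp1 : 1 ≤ p := hp.le
  obtain ⟨C, hC⟩ : ∃ C : ℝ≥0, ∀ t ∈ Icc (0 : ℝ) 1, ∀ x ∈ Ω,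
      ‖fderiv ℝ (T t) x‖ ≤ C ∧ ‖deriv (fun s => T s x) t‖ ≤ C * (1 + ‖x‖) := by
    obtain ⟨C, hC⟩ := hT_bound
    refine ⟨C.toNNReal, fun t ht x hx => ⟨(hC t ht x hx).1.trans (Real.le_coe_toNNReal C),
      (hC t ht x hx).2.trans ?_⟩⟩
    gcongr
    exact Real.le_coe_toNNReal C
  have hsupp (t : ℝ) (ht : t ∈ Icc (0 : ℝ) 1) : μ t Ωᶜ = 0 := (hμ.1 t ht).2.1
  have hw : ∀ᵐ t ∂volume.restrict (Icc (0 : ℝ) 1),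
      MemLp (transportedVelocity T v t) (ENNReal.ofReal p) (μ t) := by
    filter_upwards [hv.1, ae_restrict_mem measurableSet_Icc] with t hvt ht
    have := (hμ.1 t ht).1
    exact memLp_transportedVelocity hΩ_closed.measurableSet hT_smooth ht (hC t ht) (hsupp t ht)
      ((memLp_id_iff (by linarith)).2 (hμ.1 t ht).2.2) hvt
  refine ⟨hμ.map hp1 hΩ_closed hΩ_convex hT_smooth hT_diffeo hC,
    exists_isPushforwardField hΩ_closed.measurableSet hsupp hT_diffeo ?_, fun v' hv' =>
      hv'.isVelocityField hp1 hΩ_closed hΩ_convex hμ hT_smooth hT_diffeo hw hv⟩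
  filter_upwards [hw, ae_restrict_mem measurableSet_Icc] with t hwt ht
  have := (hμ.1 t ht).1
  exact hwt.integrable (ENNReal.one_le_ofReal.2 hp1)
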